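/- **Session types.** Terms are generated by $$S ::= \mathsf{end} \mid {?}[S_1,\dots,S_n].S \mid {!}[S_1,\dots,S_n].S \mid \oplus\{l_i:S_i\}_{1\le i\le n} \mid \&\{l_i:S_i\}_{1\le i\le n} \mid \mu X.S \mid X ,$$ up to renaming of bound variables. A *session type* is a closed term in which the labels of each choice are pairwise distinct and which is contractive (no subterm $\mu X_1.\mu X_2.\cdots\mu X_n.X_1$ with $n\ge 1$). The size is $|\mathsf{end}|=|X|=1$, $|\mu X.T|=|T|+1$, $|{?}[T_1,\dots,T_n].U|=|{!}[T_1,\dots,T_n].U|=\sum_i|T_i|+|U|+1$, $|\oplus\{l_i:T_i\}|=|\&\{l_i:T_i\}|=\sum_i|T_i|+1$. **Gay and Hole's inductive algorithm.** On input $(T,U)$ the algorithm searches for a derivation of $\emptyset\vdash T\le U$, bottom-up, depth first, without memoization, with the following rules for judgements $\Gamma\vdash T\le U$, where $\Gamma$ is a list of assumed inequalities: * (Assump) $\Gamma\vdash T\le U$ if $(T\le U)\in\Gamma$; * (End) $\Gamma\vdash\mathsf{end}\le\mathsf{end}$; * (RecL) $\Gamma\vdash\mu X.T\le U$ if $\Gamma,\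 \mu X.T\le U\vdash T[\mu X.T/X]\le U$; * (RecR) $\Gamma\vdash T\le\mu X.U$ if $\Gamma,\ T\le\mu X.U\vdash T\le U[\mu X.U/X]$; * (In) $\Gamma\vdash{?}[T_1,\dots,T_n].S\le{?}[U_1,\dots,U_n].S'$ if $\Gamma\vdash T_i\le U_i$ for all $i$ and $\Gamma\vdash S\le S'$; * (Out) $\Gamma\vdash{!}[T_1,\dots,T_n].S\le{!}[U_1,\dots,U_n].S'$ if $\Gamma\vdash U_i\le T_i$ for all $i$ and $\Gamma\vdash S\le S'$; * (Branch) $\Gamma\vdash\&\{l:T_l\}_{l\in L}\le\&\{l:U_l\}_{l\in M}$ if $L\subseteq M$ and $\Gamma\vdash T_l\le U_l$ for all $l\in L$; * (Select) $\Gamma\vdash\oplus\{l:T_l\}_{l\in L}\le\oplus\{l:U_l\}_{l\in M}$ if $M\subseteq L$ and $\Gamma\vdash T_l\le U_l$ for all $l\in M$. (Assump) has priority over all other rules, and (RecL) over (RecR). The algorithm answers "false" at the first judgement to which no rule applies, and "true" once no judgement is left. **Time.** At each judgement the algorithm is charged for comparing it symbol by symbol with every entry of $\Gamma$, and, if another rule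 than (Assump) is tried, for writing out the unfolded type symbol by symbol in (RecL) and (RecR), for traversing the payload lists in (In) and (Out), and for comparing each label of one choice with each label of the other in (Branch) and (Select). Comparing two names is one step. **Theorem.** For session types $T,U$ put $n=|T|+|U|$. 1. The algorithm halts on every pair $(T,U)$, and it takes $O(n^{n^3})$ steps: there is a constant $C$ such that for all session types $T,U$ it takes at most $C\,n^{n^3}$ steps. 2. Its worst-case running time is $\Omega((\sqrt n)!)$, where $x!=\Gamma(x+1)$ (here $\Gamma$ is Euler's function): there is a constant $c>0$ such that for every sufficiently large $n$ there are session types $T,U$ with $|T|+|U|=n$ on which the algorithm halts after visiting at least $c\,(\sqrt n)!$ judgements; as every visited judgement costs at least one step, it takes at least that many steps. 3. The bound in 1 improves the earlier doubly exponential bound $O(n^{2^n})$: $n^{n^3}=o\bigl(n^{2^n}\bigr)$. -/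

import Mathlib

namespace SessionSubtyping

/-- Raw session types, with type variables as de Bruijn indices (`var 0` is bound by the
innermost enclosing `mu`) and labels as natural numbers: `tend` is inaction,
`inp Ts S` is `?[T₁,…,Tₙ]S`, `out Ts S` is `![T₁,…,Tₙ]S`, `sel l Ts` is the selection
`⊕{lᵢ : Tᵢ}`, `bra l Ts` is the branching `&{lᵢ : Tᵢ}`, and `mu T` is `μX.T`. -/
inductive SType : Type
  | tend : SType
  | inp {n : ℕ} (Ts : Fin n → SType) (S : SType) : SType
  | out {n : ℕ} (Ts : Fin n → SType) (S : SType) : SType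
  | sel {n : ℕ} (l : Fin n → ℕ) (Ts : Fin n → SType) : SType
  | bra {n : ℕ} (l : Fin n → ℕ) (Ts : Fin n → SType) : SType
  | mu (T : SType) : SType
  | var (i : ℕ) : SType

namespace SType

/-- The size `|T|`. -/
def size : SType → ℕ
  | tend => 1
  | inp Ts S => (∑ i, (Ts i).size) + S.size + 1
  | out Ts S => (∑ i, (Ts i).size) + S.size + 1
  | sel _ Ts => (∑ i, (Ts i).size) + 1
  | bra _ Ts => (∑ i, (Ts i).size) + 1
  | mu T => T.size + 1
  | var _ => 1

/-- `T.subst R k` replaces the variable with index `k` by `R`. The indices in `R` are not shifted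
under binders: `R` is meant to be closed. -/
def subst (R : SType) : ℕ → SType → SType
  | _, tend => tend
  | k, inp Ts S => inp (fun i => subst R k (Ts i)) (subst R k S)
  | k, out Ts S => out (fun i => subst R k (Ts i)) (subst R k S)
  | k, sel l Ts => sel l (fun i => subst R k (Ts i))
  | k, bra l Ts => bra l (fun i => subst R k (Ts i))
  | k, mu T => mu (subst R (k + 1) T)
  | k, var i => if i = k then R else if k < i then var (i - 1) else var i

/-- One unfolding `T[μX.T/X]` of the recursive type `μX.T`. -/
def unroll (T : SType) : SType := subst (mu T) 0 T

/-- All free variables have an index below `k`. -/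
def ClosedAt : ℕ → SType → Prop
  | _, tend => True
  | k, inp Ts S => (∀ i, ClosedAt k (Ts i)) ∧ ClosedAt k S
  | k, out Ts S => (∀ i, ClosedAt k (Ts i)) ∧ ClosedAt k S
  | k, sel _ Ts => ∀ i, ClosedAt k (Ts i)
  | k, bra _ Ts => ∀ i, ClosedAt k (Ts i)
  | k, mu T => ClosedAt (k + 1) T
  | k, var i => i < k

/-- `μX₁.…μXₖ.T`. -/
def mus : ℕ → SType → SType
  | 0, T => T
  | k + 1, T => mu (mus k T)

/-- Contractivity: no subterm has the form `μX₁.μX₂.…μXₙ.X₁` with `n ≥ 1`. -/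
def Contractive : SType → Prop
  | tend => True
  | inp Ts S => (∀ i, (Ts i).Contractive) ∧ S.Contractive
  | out Ts S => (∀ i, (Ts i).Contractive) ∧ S.Contractive
  | sel _ Ts => ∀ i, (Ts i).Contractive
  | bra _ Ts => ∀ i, (Ts i).Contractive
  | mu T => (∀ k, T ≠ mus k (var k)) ∧ T.Contractive
  | var _ => True

/-- The labels of each selection and of each branching are pairwise distinct. -/
def LabelsDistinct : SType → Prop
  | tend => True
  | inp Ts S => (∀ i, (Ts i).LabelsDistinct) ∧ S.LabelsDistinct
  | out Ts S => (∀ i, (Ts i).LabelsDistinct) ∧ S.LabelsDistinct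
  | sel l Ts => Function.Injective l ∧ ∀ i, (Ts i).LabelsDistinct
  | bra l Ts => Function.Injective l ∧ ∀ i, (Ts i).LabelsDistinct
  | mu T => T.LabelsDistinct
  | var _ => True

/-- Session types: closed contractive terms with distinct labels in each choice. -/
structure IsSessionType (T : SType) : Prop where
  closed : T.ClosedAt 0
  contractive : T.Contractive
  labelsDistinct : T.LabelsDistinct

/-- Structural equality test. -/
def eqb : SType → SType → Bool
  | tend, tend => true
  | @inp m Ts S, @inp n Us S' =>
      if h : m = n then decide (∀ i, eqb (Ts i) (Us (i.cast h)) = true) && eqb S S' else false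
  | @out m Ts S, @out n Us S' =>
      if h : m = n then decide (∀ i, eqb (Ts i) (Us (i.cast h)) = true) && eqb S S' else false
  | @sel m l Ts, @sel n l' Us =>
      if h : m = n then
        decide (∀ i, l i = l' (i.cast h)) && decide (∀ i, eqb (Ts i) (Us (i.cast h)) = true)
      else false
  | @bra m l Ts, @bra n l' Us =>
      if h : m = n then
        decide (∀ i, l i = l' (i.cast h)) && decide (∀ i, eqb (Ts i) (Us (i.cast h)) = true)
      else false
  | mu T, mu U => eqb T U
  | var i, var j => decide (i = j)
  | _, _ => false

theorem eqb_iff (T U : SType) : eqb T U = true ↔ T = U := by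
  induction T generalizing U with
  | tend => cases U <;> simp [eqb]
  | var i => cases U <;> simp [eqb]
  | mu T ih => cases U <;> simp [eqb, ih]
  | @inp m Ts S ih ihS =>
    cases U with
    | @inp n Us S' =>
      by_cases h : m = n
      · subst h; simp [eqb, ih, ihS, funext_iff]
      · simp [eqb, h]
    | _ => simp [eqb]
  | @out m Ts S ih ihS =>
    cases U with
    | @out n Us S' =>
      by_cases h : m = n
      · subst h; simp [eqb, ih, ihS, funext_iff]
      · simp [eqb, h]
    | _ => simp [eqb]
  | @sel m l Ts ih =>
    cases U with
    | @sel n l' Us =>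
      by_cases h : m = n
      · subst h; simp [eqb, ih, funext_iff]
      · simp [eqb, h]
    | _ => simp [eqb]
  | @bra m l Ts ih =>
    cases U with
    | @bra n l' Us =>
      by_cases h : m = n
      · subst h; simp [eqb, ih, funext_iff]
      · simp [eqb, h]
    | _ => simp [eqb]

instance : DecidableEq SType := fun T U => decidable_of_iff _ (eqb_iff T U)

end SType

open SType

/-- A judgement `Γ ⊢ T ≤ U`, where `Γ` is a list of assumed inequalities. -/
structure Judgement : Type where
  ctx : List (SType × SType)
  lhs : SType
  rhs : SType

/-- The premises of the syntax-directed rule for `Γ ⊢ T ≤ U`, the assumption rule apart; `none` if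
there is no such rule. If both sides are recursive types, the left one is unfolded. -/
def rulePremises (Γ : List (SType × SType)) : SType → SType → Option (List Judgement)
  | mu T, U => some [⟨(mu T, U) :: Γ, unroll T, U⟩]
  | T, mu U => some [⟨(T, mu U) :: Γ, T, unroll U⟩]
  | tend, tend => some []
  | @inp m Ts S, @inp n Us S' =>
      if h : m = n then
        some ((List.finRange m).map (fun i => ⟨Γ, Ts i, Us (i.cast h)⟩) ++ [⟨Γ, S, S'⟩])
      else none
  | @out m Ts S, @out n Us S' =>
      if h : m = n then
        some ((List.finRange m).map (fun i => ⟨Γ, Us (i.cast h), Ts i⟩) ++ [⟨Γ, S, S'⟩])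
      else none
  | @bra m l Ts, @bra n l' Us =>
      if ∀ i, ∃ j, l' j = l i then
        some ((List.finRange m).flatMap fun i =>
          ((List.finRange n).filter fun j => l' j = l i).map fun j => ⟨Γ, Ts i, Us j⟩)
      else none
  | @sel m l Ts, @sel n l' Us =>
      if ∀ j, ∃ i, l i = l' j then
        some ((List.finRange n).flatMap fun j =>
          ((List.finRange m).filter fun i => l i = l' j).map fun i => ⟨Γ, Ts i, Us j⟩)
      else none
  | _, _ => none

/-- The premises of the rule that the algorithm applies to a judgement: the assumption rule whenever
it is applicable, otherwise the syntax-directed rule. -/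
def Judgement.premises (J : Judgement) : Option (List Judgement) :=
  if (J.lhs, J.rhs) ∈ J.ctx then some [] else rulePremises J.ctx J.lhs J.rhs

/-- Steps for the search for `T ≤ U` in the list of assumptions: it is compared, symbol by symbol,
with each entry. -/
def lookupCost (Γ : List (SType × SType)) (T U : SType) : ℕ :=
  1 + (Γ.map fun A => A.1.size + A.2.size + T.size + U.size).sum

/-- Steps for the application of the syntax-directed rule: an unfolding writes out the unfolded
type symbol by symbol, payload lists are traversed, and each label of one choice is compared with
each label of the other. -/
def ruleCost : SType → SType → ℕ
  | mu T, _ => 1 + (unroll T).size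
  | _, mu U => 1 + (unroll U).size
  | @inp m _ _, @inp n _ _ => 1 + m + n
  | @out m _ _, @out n _ _ => 1 + m + n
  | @bra m _ _, @bra n _ _ => (1 + m) * (1 + n)
  | @sel m _ _, @sel n _ _ => (1 + m) * (1 + n)
  | _, _ => 1

/-- Steps that the algorithm spends on a judgement, without its premises. -/
def Judgement.cost (J : Judgement) : ℕ :=
  if (J.lhs, J.rhs) ∈ J.ctx then lookupCost J.ctx J.lhs J.rhs
  else lookupCost J.ctx J.lhs J.rhs + ruleCost J.lhs J.rhs

/-- The verdict of a run, the number of judgements visited and the number of steps taken. -/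
structure Outcome : Type where
  verdict : Bool
  judgements : ℕ
  steps : ℕ

/-- Depth-first, left-to-right construction of the derivation trees of the judgements on a stack.
The search answers `true` once no judgement is left, and `false` at the first judgement to which no
rule applies; there is no memoization. The first argument bounds the number of judgements visited,
with the value `none` if that many do not suffice. -/
def search : ℕ → List Judgement → Option Outcome
  | _, [] => some ⟨true, 0, 0⟩
  | 0, _ :: _ => none
  | k + 1, J :: Js =>
      match J.premises with
      | none => some ⟨false, 1, J.cost⟩
      | some Ps =>
          (search k (Ps ++ Js)).map fun r => ⟨r.verdict, r.judgements + 1, r.steps + J.cost⟩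

/-- The algorithm, started on `∅ ⊢ T ≤ U`, halts with outcome `r`. -/
def RunsTo (T U : SType) (r : Outcome) : Prop := ∃ k, search k [⟨[], T, U⟩] = some r

theorem search_succ {k : ℕ} {Js : List Judgement} {r : Outcome} (h : search k Js = some r) :
    search (k + 1) Js = some r := by
  induction k generalizing Js r with
  | zero => cases Js <;> simp_all [search]
  | succ k ih =>
    cases Js with
    | nil => simpa [search] using h
    | cons J Js =>
      rw [search] at h ⊢
      cases hp : J.premises with
      | none => simpa [hp] using h
      | some Ps =>
        simp only [hp, Option.map_eq_some_iff] at h ⊢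
        obtain ⟨a, ha, rfl⟩ := h
        exact ⟨a, ih ha, rfl⟩

/-- The outcome of a run is unique. -/
theorem RunsTo.unique {T U : SType} {r s : Outcome} (hr : RunsTo T U r) (hs : RunsTo T U s) :
    r = s := by
  have mono : ∀ {k Js r}, search k Js = some r → ∀ d, search (k + d) Js = some r := by
    intro k Js r h d
    induction d with
    | zero => exact h
    | succ d ih => exact search_succ ih
  obtain ⟨a, ha⟩ := hr
  obtain ⟨b, hb⟩ := hs
  have h1 := mono ha b
  have h2 := mono hb a
  rw [Nat.add_comm] at h2
  exact Option.some.inj (h1.symm.trans h2)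

end SessionSubtyping

/-! Upper bound. Unfolding a closed type never leads outside a finite set: every type met is the
instance of a non-variable subterm of the input, with each free variable replaced by the recursive
type that binds it (`reach`, `reach_step`). So at most `|T|` types come from `T` and at most `|U|`
from `U`. Since (Out) exchanges the sides, the pairs met lie in a set of at most `2|T||U| ≤ n²/2`
elements. Each unfolding adds an assumption. As (Assump) has priority, the assumptions on a branch
are distinct, which leaves at most `n²/2` unfoldings. Between two unfoldings every rule goes down in
both types above their recursive subterms, and the smaller of these parts has size at most `n/2`.
Hence derivations have height about `n³/4` (`Judgement.rank`). Each judgement has at most `n² + 1`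
premises, and its cost is governed by the size `2nⁿ` of the types met. The product is below `n^(n³)`
for `n ≥ 10` (`PairBound.search_halts`, `stepBound_le`).

Lower bound. Compare `μX.?[X].?[X].X` with a ladder of nested recursive inputs. Let `f j` be the
work for `?[loop].loop` against rung `j`. The payload of (In) stays on the current rung, the
continuation descends, and `f (j + 2) ≥ f (j + 1) + f j` (`visitsAtLeast_pow`). Without memoization
this growth is exponential in `n`, whereas `(√n)!` is only `2^O(√n log n)`. -/

namespace SessionSubtyping

/-! ### Simultaneous substitution of closed types -/

namespace SType

theorem ClosedAt.mono {T : SType} {j k : ℕ} (h : T.ClosedAt j) (hjk : j ≤ k) : T.ClosedAt k := by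
  induction T generalizing j k with
  | tend => trivial
  | inp Ts S ih ihS => exact ⟨fun i => ih i (h.1 i) hjk, ihS h.2 hjk⟩
  | out Ts S ih ihS => exact ⟨fun i => ih i (h.1 i) hjk, ihS h.2 hjk⟩
  | sel l Ts ih => exact fun i => ih i (h i) hjk
  | bra l Ts ih => exact fun i => ih i (h i) hjk
  | mu T ih => exact ih (j := j + 1) (k := k + 1) h (by omega)
  | var i => exact lt_of_lt_of_le h hjk

theorem ClosedAt.subst_eq {T : SType} {k : ℕ} (h : T.ClosedAt k) (R : SType) :
    subst R k T = T := by
  induction T generalizing k with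
  | tend => rfl
  | inp Ts S ih ihS => simp only [subst, ihS h.2, fun i => ih i (h.1 i)]
  | out Ts S ih ihS => simp only [subst, ihS h.2, fun i => ih i (h.1 i)]
  | sel l Ts ih => simp only [subst, fun i => ih i (h i)]
  | bra l Ts ih => simp only [subst, fun i => ih i (h i)]
  | mu T ih => simp only [subst, ih (k := k + 1) h]
  | var i =>
    have : i < k := h
    simp [subst, this.ne, this.le]

/-- `psub σ k T` replaces each variable `k + i` of `T` by the (closed) type `σ i`. -/
def psub (σ : ℕ → SType) : ℕ → SType → SType
  | _, tend => tend
  | k, inp Ts S => inp (fun i => psub σ k (Ts i)) (psub σ k S)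
  | k, out Ts S => out (fun i => psub σ k (Ts i)) (psub σ k S)
  | k, sel l Ts => sel l (fun i => psub σ k (Ts i))
  | k, bra l Ts => bra l (fun i => psub σ k (Ts i))
  | k, mu T => mu (psub σ (k + 1) T)
  | k, var i => if i < k then var i else σ (i - k)

/-- The environment that maps `0` to `R` and `i + 1` to `σ i`. -/
def extend (R : SType) (σ : ℕ → SType) : ℕ → SType
  | 0 => R
  | i + 1 => σ i

theorem ClosedAt.psub_eq {T : SType} {k : ℕ} (h : T.ClosedAt k) (σ : ℕ → SType) :
    psub σ k T = T := by
  induction T generalizing k with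
  | tend => rfl
  | inp Ts S ih ihS => simp only [psub, ihS h.2, fun i => ih i (h.1 i)]
  | out Ts S ih ihS => simp only [psub, ihS h.2, fun i => ih i (h.1 i)]
  | sel l Ts ih => simp only [psub, fun i => ih i (h i)]
  | bra l Ts ih => simp only [psub, fun i => ih i (h i)]
  | mu T ih => simp only [psub, ih (k := k + 1) h]
  | var i =>
    have : i < k := h
    simp [psub, this]

/-- The types in the environment are closed and recursive. -/
def ClosedMuEnv (σ : ℕ → SType) : Prop := ∀ i, (σ i).ClosedAt 0 ∧ ∃ R, σ i = mu R

theorem closedAt_psub {σ : ℕ → SType} (hσ : ClosedMuEnv σ) (k : ℕ) (T : SType) :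
    (psub σ k T).ClosedAt k := by
  induction T generalizing k with
  | tend => trivial
  | inp Ts S ih ihS => exact ⟨fun i => ih i k, ihS k⟩
  | out Ts S ih ihS => exact ⟨fun i => ih i k, ihS k⟩
  | sel l Ts ih => exact fun i => ih i k
  | bra l Ts ih => exact fun i => ih i k
  | mu T ih => exact ih (k + 1)
  | var i =>
    by_cases h : i < k
    · simp [psub, h, ClosedAt]
    · simpa [psub, h] using (hσ (i - k)).1.mono (Nat.zero_le k)

theorem ClosedMuEnv.extend {σ : ℕ → SType} (hσ : ClosedMuEnv σ) (T : SType) :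
    ClosedMuEnv (extend (psub σ 0 (mu T)) σ) := by
  rintro (_ | i)
  · exact ⟨closedAt_psub hσ 0 (mu T), _, rfl⟩
  · exact hσ i

/-- Types in the environment are closed, so a later substitution leaves them alone. This makes
successive unfoldings of nested binders collapse into one environment, and unfolding an instance
again gives an instance of the same body. -/
theorem subst_psub {σ : ℕ → SType} (hσ : ClosedMuEnv σ) (R : SType) (k : ℕ) (T : SType) :
    subst R k (psub σ (k + 1) T) = psub (extend R σ) k T := by
  induction T generalizing k with
  | tend => rfl
  | inp Ts S ih ihS => simp only [psub, subst, ih, ihS]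
  | out Ts S ih ihS => simp only [psub, subst, ih, ihS]
  | sel l Ts ih => simp only [psub, subst, ih]
  | bra l Ts ih => simp only [psub, subst, ih]
  | mu T ih => simp only [psub, subst, ih]
  | var i =>
    rcases lt_trichotomy i k with h | rfl | h
    · simp [psub, subst, h, h.ne, h.le, Nat.lt_succ_of_lt h]
    · simp [psub, subst, SType.extend]
    · obtain ⟨j, rfl⟩ : ∃ j, i = k + (j + 1) := ⟨i - k - 1, by omega⟩
      have h1 : k + (j + 1) - (k + 1) = j := by omega
      have h2 : k + (j + 1) - k = j + 1 := by omega
      simp only [psub, if_neg (show ¬ k + (j + 1) < k + 1 by omega),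
        if_neg (show ¬ k + (j + 1) < k by omega), h1, h2, SType.extend]
      exact ((hσ j).1.mono (Nat.zero_le k)).subst_eq R

theorem unroll_psub {σ : ℕ → SType} (hσ : ClosedMuEnv σ) (T : SType) :
    unroll (psub σ 1 T) = psub (extend (psub σ 0 (mu T)) σ) 0 T :=
  subst_psub hσ _ 0 T

/-! ### The finitely many types reachable from a closed type -/

/-- The components of a type and, for a recursive type, its unfolding. -/
inductive Step : SType → SType → Prop
  | inp_arg {n : ℕ} (Ts : Fin n → SType) (S : SType) (i : Fin n) : Step (inp Ts S) (Ts i)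
  | inp_cont {n : ℕ} (Ts : Fin n → SType) (S : SType) : Step (inp Ts S) S
  | out_arg {n : ℕ} (Ts : Fin n → SType) (S : SType) (i : Fin n) : Step (out Ts S) (Ts i)
  | out_cont {n : ℕ} (Ts : Fin n → SType) (S : SType) : Step (out Ts S) S
  | sel {n : ℕ} (l : Fin n → ℕ) (Ts : Fin n → SType) (i : Fin n) : Step (sel l Ts) (Ts i)
  | bra {n : ℕ} (l : Fin n → ℕ) (Ts : Fin n → SType) (i : Fin n) : Step (bra l Ts) (Ts i)
  | mu (T : SType) : Step (mu T) (unroll T)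

/-- The instances, under the environment, of the subterms of `T` other than variables. -/
def reach : (ℕ → SType) → SType → Finset SType
  | _, tend => {tend}
  | σ, inp Ts S =>
      insert (psub σ 0 (inp Ts S)) ((Finset.univ.biUnion fun i => reach σ (Ts i)) ∪ reach σ S)
  | σ, out Ts S =>
      insert (psub σ 0 (out Ts S)) ((Finset.univ.biUnion fun i => reach σ (Ts i)) ∪ reach σ S)
  | σ, sel l Ts =>
      insert (psub σ 0 (sel l Ts)) (Finset.univ.biUnion fun i => reach σ (Ts i))
  | σ, bra l Ts =>
      insert (psub σ 0 (bra l Ts)) (Finset.univ.biUnion fun i => reach σ (Ts i))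
  | σ, mu T => insert (psub σ 0 (mu T)) (reach (extend (psub σ 0 (mu T)) σ) T)
  | _, var _ => ∅

theorem card_reach_le (σ : ℕ → SType) (T : SType) : (reach σ T).card ≤ T.size := by
  induction T generalizing σ with
  | tend => simp [reach, size]
  | inp Ts S ih ihS =>
    refine (Finset.card_insert_le _ _).trans (Nat.succ_le_succ ?_)
    refine (Finset.card_union_le _ _).trans (Nat.add_le_add ?_ (ihS σ))
    exact Finset.card_biUnion_le.trans (Finset.sum_le_sum fun i _ => ih i σ)
  | out Ts S ih ihS =>
    refine (Finset.card_insert_le _ _).trans (Nat.succ_le_succ ?_)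
    refine (Finset.card_union_le _ _).trans (Nat.add_le_add ?_ (ihS σ))
    exact Finset.card_biUnion_le.trans (Finset.sum_le_sum fun i _ => ih i σ)
  | sel l Ts ih =>
    refine (Finset.card_insert_le _ _).trans (Nat.succ_le_succ ?_)
    exact Finset.card_biUnion_le.trans (Finset.sum_le_sum fun i _ => ih i σ)
  | bra l Ts ih =>
    refine (Finset.card_insert_le _ _).trans (Nat.succ_le_succ ?_)
    exact Finset.card_biUnion_le.trans (Finset.sum_le_sum fun i _ => ih i σ)
  | mu T ih => exact (Finset.card_insert_le _ _).trans (Nat.succ_le_succ (ih _))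
  | var i => simp [reach, size]

theorem psub_mem_reach (σ : ℕ → SType) {k : ℕ} {T : SType} (h : T.ClosedAt k) :
    psub σ 0 T ∈ reach σ T ∨ ∃ i < k, psub σ 0 T = σ i := by
  cases T with
  | var i => exact Or.inr ⟨i, h, by simp [psub]⟩
  | _ => simp [reach, psub]

/-- A step can leave `reach σ T` only through a variable of `T`, whose instance is an entry of `σ`.
Under a binder, entry `0` is the recursive type itself, which `reach` has already counted; for
closed `T` no escape remains. -/
theorem reach_step {σ : ℕ → SType} (hσ : ClosedMuEnv σ) {k : ℕ} {T X Y : SType}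
    (hT : T.ClosedAt k) (hX : X ∈ reach σ T) (hXY : Step X Y) :
    Y ∈ reach σ T ∨ ∃ i < k, Y = σ i := by
  induction T generalizing σ k with
  | tend =>
    obtain rfl : X = tend := by simpa [reach] using hX
    cases hXY
  | inp Ts S ih ihS =>
    simp only [reach, Finset.mem_insert, Finset.mem_union, Finset.mem_biUnion, Finset.mem_univ,
      true_and] at hX ⊢
    rcases hX with rfl | ⟨i, hi⟩ | hS
    · rw [psub] at hXY
      cases hXY with
      | inp_arg _ _ i => exact (psub_mem_reach σ (hT.1 i)).imp_left fun h => .inr (.inl ⟨i, h⟩)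
      | inp_cont => exact (psub_mem_reach σ hT.2).imp_left fun h => .inr (.inr h)
    · exact (ih i hσ (hT.1 i) hi).imp_left fun h => .inr (.inl ⟨i, h⟩)
    · exact (ihS hσ hT.2 hS).imp_left fun h => .inr (.inr h)
  | out Ts S ih ihS =>
    simp only [reach, Finset.mem_insert, Finset.mem_union, Finset.mem_biUnion, Finset.mem_univ,
      true_and] at hX ⊢
    rcases hX with rfl | ⟨i, hi⟩ | hS
    · rw [psub] at hXY
      cases hXY with
      | out_arg _ _ i => exact (psub_mem_reach σ (hT.1 i)).imp_left fun h => .inr (.inl ⟨i, h⟩)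
      | out_cont => exact (psub_mem_reach σ hT.2).imp_left fun h => .inr (.inr h)
    · exact (ih i hσ (hT.1 i) hi).imp_left fun h => .inr (.inl ⟨i, h⟩)
    · exact (ihS hσ hT.2 hS).imp_left fun h => .inr (.inr h)
  | sel l Ts ih =>
    simp only [reach, Finset.mem_insert, Finset.mem_biUnion, Finset.mem_univ, true_and] at hX ⊢
    rcases hX with rfl | ⟨i, hi⟩
    · rw [psub] at hXY
      cases hXY with
      | sel _ _ i => exact (psub_mem_reach σ (hT i)).imp_left fun h => .inr ⟨i, h⟩
    · exact (ih i hσ (hT i) hi).imp_left fun h => .inr ⟨i, h⟩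
  | bra l Ts ih =>
    simp only [reach, Finset.mem_insert, Finset.mem_biUnion, Finset.mem_univ, true_and] at hX ⊢
    rcases hX with rfl | ⟨i, hi⟩
    · rw [psub] at hXY
      cases hXY with
      | bra _ _ i => exact (psub_mem_reach σ (hT i)).imp_left fun h => .inr ⟨i, h⟩
    · exact (ih i hσ (hT i) hi).imp_left fun h => .inr ⟨i, h⟩
  | mu T ih =>
    have key : (Y ∈ reach (extend (psub σ 0 (mu T)) σ) T ∨
        ∃ i < k + 1, Y = extend (psub σ 0 (mu T)) σ i) →
        Y ∈ reach σ (mu T) ∨ ∃ i < k, Y = σ i := by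
      rintro (h | ⟨_ | i, hi, rfl⟩)
      · exact .inl (Finset.mem_insert_of_mem h)
      · exact .inl (Finset.mem_insert_self _ _)
      · exact .inr ⟨i, by omega, rfl⟩
    rcases Finset.mem_insert.1 hX with rfl | hX
    · rw [psub] at hXY
      cases hXY with
      | mu =>
        rw [zero_add, unroll_psub hσ] at key ⊢
        exact key (psub_mem_reach _ (k := k + 1) hT)
    · exact key (ih (hσ.extend T) (k := k + 1) hT hX)
  | var i => simp [reach] at hX

/-! ### Sizes of the reachable types -/

theorem one_le_size (T : SType) : 1 ≤ T.size := by
  cases T <;> simp [size]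

/-- The size of the part of a type above the recursive subterms. -/
def guardedSize : SType → ℕ
  | tend => 1
  | inp Ts S => (∑ i, (Ts i).guardedSize) + S.guardedSize + 1
  | out Ts S => (∑ i, (Ts i).guardedSize) + S.guardedSize + 1
  | sel _ Ts => (∑ i, (Ts i).guardedSize) + 1
  | bra _ Ts => (∑ i, (Ts i).guardedSize) + 1
  | mu _ => 0
  | var _ => 0

/-- The number of components of a type. -/
def arity : SType → ℕ
  | @inp n _ _ => n + 1
  | @out n _ _ => n + 1
  | @sel n _ _ => n
  | @bra n _ _ => n
  | _ => 0

theorem guardedSize_le_size (T : SType) : T.guardedSize ≤ T.size := by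
  induction T with
  | tend => simp [guardedSize, size]
  | inp Ts S ih ihS =>
    have := Finset.sum_le_sum fun i (_ : i ∈ Finset.univ) => ih i
    simp only [guardedSize, size]; omega
  | out Ts S ih ihS =>
    have := Finset.sum_le_sum fun i (_ : i ∈ Finset.univ) => ih i
    simp only [guardedSize, size]; omega
  | sel l Ts ih =>
    have := Finset.sum_le_sum fun i (_ : i ∈ Finset.univ) => ih i
    simp only [guardedSize, size]; omega
  | bra l Ts ih =>
    have := Finset.sum_le_sum fun i (_ : i ∈ Finset.univ) => ih i
    simp only [guardedSize, size]; omega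
  | mu T => simp [guardedSize]
  | var i => simp [guardedSize]

theorem card_le_sum_size {n : ℕ} (Ts : Fin n → SType) : n ≤ ∑ i, (Ts i).size := by
  have := Finset.sum_le_sum fun i (_ : i ∈ Finset.univ) => one_le_size (Ts i)
  simpa using this

theorem arity_le_size (T : SType) : T.arity ≤ T.size := by
  cases T with
  | inp Ts S =>
    have := card_le_sum_size Ts
    simp only [arity, size]; omega
  | out Ts S =>
    have := card_le_sum_size Ts
    simp only [arity, size]; omega
  | sel l Ts =>
    have := card_le_sum_size Ts
    simp only [arity, size]; omega
  | bra l Ts =>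
    have := card_le_sum_size Ts
    simp only [arity, size]; omega
  | _ => simp [arity]

/-- Variables and recursive types both count 0, and only recursive types are substituted. This is
why `ClosedMuEnv` insists on recursive types. -/
theorem guardedSize_psub {σ : ℕ → SType} (hσ : ClosedMuEnv σ) (k : ℕ) (T : SType) :
    (psub σ k T).guardedSize = T.guardedSize := by
  induction T generalizing k with
  | var i =>
    obtain ⟨R, hR⟩ := (hσ (i - k)).2
    by_cases h : i < k <;> simp [psub, h, guardedSize, hR]
  | _ => simp_all [psub, guardedSize]

theorem arity_psub {σ : ℕ → SType} (hσ : ClosedMuEnv σ) (k : ℕ) (T : SType) :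
    (psub σ k T).arity = T.arity := by
  cases T with
  | var i =>
    obtain ⟨R, hR⟩ := (hσ (i - k)).2
    by_cases h : i < k <;> simp [psub, h, arity, hR]
  | _ => simp [psub, arity]

theorem size_psub_le {σ : ℕ → SType} {M : ℕ} (hM : 1 ≤ M) (hσ : ∀ i, (σ i).size ≤ M) (k : ℕ)
    (T : SType) : (psub σ k T).size ≤ T.size * M := by
  induction T generalizing k with
  | tend => simpa [psub, size] using hM
  | inp Ts S ih ihS =>
    have h := Finset.sum_le_sum fun i (_ : i ∈ Finset.univ) => ih i k
    rw [← Finset.sum_mul] at h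
    simp only [psub, size, add_mul, one_mul]
    exact Nat.add_le_add (Nat.add_le_add h (ihS k)) hM
  | out Ts S ih ihS =>
    have h := Finset.sum_le_sum fun i (_ : i ∈ Finset.univ) => ih i k
    rw [← Finset.sum_mul] at h
    simp only [psub, size, add_mul, one_mul]
    exact Nat.add_le_add (Nat.add_le_add h (ihS k)) hM
  | sel l Ts ih =>
    have h := Finset.sum_le_sum fun i (_ : i ∈ Finset.univ) => ih i k
    rw [← Finset.sum_mul] at h
    simp only [psub, size, add_mul, one_mul]
    exact Nat.add_le_add h hM
  | bra l Ts ih =>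
    have h := Finset.sum_le_sum fun i (_ : i ∈ Finset.univ) => ih i k
    rw [← Finset.sum_mul] at h
    simp only [psub, size, add_mul, one_mul]
    exact Nat.add_le_add h hM
  | mu T ih =>
    simp only [psub, size, add_mul, one_mul]
    exact Nat.add_le_add (ih (k + 1)) hM
  | var i =>
    by_cases h : i < k
    · simpa [psub, h, size] using hM
    · simpa [psub, h, size] using hσ (i - k)

/-- Bounds for the members of `reach σ T`. -/
theorem bounds_of_mem_reach {σ : ℕ → SType} {M : ℕ} (hM : 1 ≤ M) (hσ : ClosedMuEnv σ)
    (hσM : ∀ i, (σ i).size ≤ M) {T X : SType} (hX : X ∈ reach σ T) :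
    X.guardedSize ≤ T.size ∧ X.arity ≤ T.size ∧ X.size ≤ T.size ^ T.size * M := by
  have self : ∀ {σ : ℕ → SType} {M : ℕ}, 1 ≤ M → ClosedMuEnv σ → (∀ i, (σ i).size ≤ M) →
      ∀ T : SType, (psub σ 0 T).guardedSize ≤ T.size ∧ (psub σ 0 T).arity ≤ T.size ∧
        (psub σ 0 T).size ≤ T.size ^ T.size * M := by
    intro σ M hM hσ hσM T
    refine ⟨(guardedSize_psub hσ 0 T).le.trans T.guardedSize_le_size,
      (arity_psub hσ 0 T).le.trans T.arity_le_size,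
      (size_psub_le hM hσM 0 T).trans (Nat.mul_le_mul_right _ ?_)⟩
    exact Nat.le_self_pow (by have := T.one_le_size; omega) _
  have up : ∀ {a b M x y z : ℕ}, 1 ≤ a → a ≤ b → x ≤ a ∧ y ≤ a ∧ z ≤ a ^ a * M →
      x ≤ b ∧ y ≤ b ∧ z ≤ b ^ b * M := by
    intro a b M x y z ha hab h
    refine ⟨h.1.trans hab, h.2.1.trans hab, h.2.2.trans (Nat.mul_le_mul_right _ ?_)⟩
    exact (Nat.pow_le_pow_left hab a).trans (Nat.pow_le_pow_right (ha.trans hab) hab)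
  have single : ∀ {n : ℕ} (Ts : Fin n → SType) (i : Fin n), (Ts i).size ≤ ∑ i, (Ts i).size :=
    fun Ts i => Finset.single_le_sum (f := fun i => (Ts i).size) (fun _ _ => Nat.zero_le _)
      (Finset.mem_univ i)
  induction T generalizing σ M with
  | tend =>
    obtain rfl : X = tend := by simpa [reach] using hX
    simpa [guardedSize, arity, size] using hM
  | inp Ts S ih ihS =>
    simp only [reach, Finset.mem_insert, Finset.mem_union, Finset.mem_biUnion, Finset.mem_univ,
      true_and] at hX
    rcases hX with rfl | ⟨i, hi⟩ | hS
    · exact self hM hσ hσM _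
    · exact up (one_le_size _) (by have := single Ts i; simp only [size]; omega)
        (ih i hM hσ hσM hi)
    · exact up (one_le_size _) (by simp only [size]; omega) (ihS hM hσ hσM hS)
  | out Ts S ih ihS =>
    simp only [reach, Finset.mem_insert, Finset.mem_union, Finset.mem_biUnion, Finset.mem_univ,
      true_and] at hX
    rcases hX with rfl | ⟨i, hi⟩ | hS
    · exact self hM hσ hσM _
    · exact up (one_le_size _) (by have := single Ts i; simp only [size]; omega)
        (ih i hM hσ hσM hi)
    · exact up (one_le_size _) (by simp only [size]; omega) (ihS hM hσ hσM hS)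
  | sel l Ts ih =>
    simp only [reach, Finset.mem_insert, Finset.mem_biUnion, Finset.mem_univ, true_and] at hX
    rcases hX with rfl | ⟨i, hi⟩
    · exact self hM hσ hσM _
    · exact up (one_le_size _) (by have := single Ts i; simp only [size]; omega)
        (ih i hM hσ hσM hi)
  | bra l Ts ih =>
    simp only [reach, Finset.mem_insert, Finset.mem_biUnion, Finset.mem_univ, true_and] at hX
    rcases hX with rfl | ⟨i, hi⟩
    · exact self hM hσ hσM _
    · exact up (one_le_size _) (by have := single Ts i; simp only [size]; omega)
        (ih i hM hσ hσM hi)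
  | mu T ih =>
    rcases Finset.mem_insert.1 hX with rfl | hX
    · exact self hM hσ hσM _
    -- Passing a binder multiplies the bound on the environment by the size of the recursive type;
    -- this supplies the extra factor in the power.
    · have hle : M ≤ (mu T).size * M := Nat.le_mul_of_pos_left M (one_le_size _)
      have hM' : ∀ i, (extend (psub σ 0 (mu T)) σ i).size ≤ (mu T).size * M := by
        rintro (_ | i)
        · exact size_psub_le hM hσM 0 _
        · exact (hσM i).trans hle
      obtain ⟨h1, h2, h3⟩ := ih (hM.trans hle) (hσ.extend T) hM' hX
      refine ⟨h1.trans (Nat.le_succ _), h2.trans (Nat.le_succ _), h3.trans ?_⟩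
      rw [← mul_assoc]
      refine Nat.mul_le_mul_right _ ?_
      rw [show (mu T).size = T.size + 1 from rfl, pow_succ]
      exact Nat.mul_le_mul_right _ (Nat.pow_le_pow_left (Nat.le_succ _) _)
  | var i => simp [reach] at hX

/-- A closed type has a finite set of iterated components that is closed under `Step`. -/
theorem exists_finset_closed_under_step {T : SType} (hT : T.ClosedAt 0) :
    ∃ A : Finset SType, T ∈ A ∧ A.card ≤ T.size ∧ (∀ X ∈ A, ∀ Y, Step X Y → Y ∈ A) ∧
      ∀ X ∈ A, X.guardedSize ≤ T.size ∧ X.arity ≤ T.size ∧ X.size ≤ 2 * T.size ^ T.size := by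
  -- A dummy environment, since `T` has no free variables; its entries have size 2, which is the
  -- factor 2 in the size bound.
  have hσ : ClosedMuEnv fun _ => mu tend := fun _ => ⟨trivial, _, rfl⟩
  refine ⟨reach (fun _ => mu tend) T, ?_, card_reach_le _ _, fun X hX Y hXY => ?_,
    fun X hX => ?_⟩
  · simpa [hT.psub_eq] using psub_mem_reach (fun _ => mu tend) hT
  · simpa using reach_step hσ hT hX hXY
  · rw [mul_comm 2]
    exact bounds_of_mem_reach one_le_two hσ (fun _ => by simp [size]) hX

end SType

open SType

/-! ### Height, branching and cost of the search -/

/-- A finite set of pairs of types that is closed under exchanging the two types and under steps of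
one type, with bounds `h`, `d`, `s` for guarded sizes, arities and sizes. -/
structure PairBound (P : Finset (SType × SType)) (h d s : ℕ) : Prop where
  symm : ∀ {X Y}, (X, Y) ∈ P → (Y, X) ∈ P
  step : ∀ {X X' Y}, (X, Y) ∈ P → Step X X' → (X', Y) ∈ P
  guardedSize_le : ∀ {X Y}, (X, Y) ∈ P → min X.guardedSize Y.guardedSize ≤ h
  arity_le : ∀ {X Y}, (X, Y) ∈ P → X.arity ≤ d
  size_le : ∀ {X Y}, (X, Y) ∈ P → X.size ≤ s

/-- The possible premises of a judgement `Γ ⊢ T ≤ U`: an unfolding of one side, with an additional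
assumption, or a pair of components. -/
inductive IsPremise (Γ : List (SType × SType)) (T U : SType) : Judgement → Prop
  | left {X : SType} : Step T X → IsPremise Γ T U ⟨(T, U) :: Γ, X, U⟩
  | right {X : SType} : Step U X → IsPremise Γ T U ⟨(T, U) :: Γ, T, X⟩
  | components {X Y : SType} : Step T X → Step U Y → X.guardedSize < T.guardedSize →
      Y.guardedSize < U.guardedSize → IsPremise Γ T U ⟨Γ, X, Y⟩
  | swapped {X Y : SType} : Step T X → Step U Y → X.guardedSize < T.guardedSize →
      Y.guardedSize < U.guardedSize → IsPremise Γ T U ⟨Γ, Y, X⟩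

theorem guardedSize_le_sum {n : ℕ} (Ts : Fin n → SType) (i : Fin n) :
    (Ts i).guardedSize ≤ ∑ i, (Ts i).guardedSize :=
  Finset.single_le_sum (f := fun i => (Ts i).guardedSize) (fun _ _ => Nat.zero_le _)
    (Finset.mem_univ i)

theorem length_flatMap_filter_le {m n : ℕ} (p : Fin m → Fin n → Bool)
    (f : Fin m → Fin n → Judgement) :
    ((List.finRange m).flatMap fun i =>
      ((List.finRange n).filter fun j => p i j).map fun j => f i j).length ≤ m * n := by
  rw [List.length_flatMap]
  refine (List.sum_le_card_nsmul _ n fun x hx => ?_).trans (by simp)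
  obtain ⟨i, -, rfl⟩ := List.mem_map.1 hx
  simpa using List.length_filter_le (fun j => p i j) (List.finRange n)

/-- The product of the arities covers payloads and label pairs; the summand 1 covers an unfolding,
where the recursive side has arity 0. -/
theorem rulePremises_spec {Γ : List (SType × SType)} {T U : SType} {Ps : List Judgement}
    (h : rulePremises Γ T U = some Ps) :
    Ps.length ≤ T.arity * U.arity + 1 ∧ ∀ J ∈ Ps, IsPremise Γ T U J := by
  unfold rulePremises at h
  split at h
  · cases h
    simpa using IsPremise.left (Step.mu _)
  · cases h
    simpa using IsPremise.right (Step.mu _)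
  · cases h
    simp
  · rename_i m Ts S n Us S'
    split at h
    · rename_i hmn
      subst hmn
      cases h
      refine ⟨by simp only [List.length_append, List.length_map, List.length_finRange,
        List.length_singleton, arity]; nlinarith, ?_⟩
      intro J hJ
      simp only [List.mem_append, List.mem_map, List.mem_finRange, true_and,
        List.mem_singleton] at hJ
      rcases hJ with ⟨i, rfl⟩ | rfl
      · refine .components (.inp_arg _ _ _) (.inp_arg _ _ _) ?_ ?_
        · have := guardedSize_le_sum Ts i
          simp only [guardedSize]; omega
        · have := guardedSize_le_sum Us i
          simp only [guardedSize, Fin.cast_eq_self]; omega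
      · refine .components (.inp_cont _ _) (.inp_cont _ _) ?_ ?_ <;>
          simp only [guardedSize] <;> omega
    · cases h
  · rename_i m Ts S n Us S'
    split at h
    · rename_i hmn
      subst hmn
      cases h
      refine ⟨by simp only [List.length_append, List.length_map, List.length_finRange,
        List.length_singleton, arity]; nlinarith, ?_⟩
      intro J hJ
      simp only [List.mem_append, List.mem_map, List.mem_finRange, true_and,
        List.mem_singleton] at hJ
      rcases hJ with ⟨i, rfl⟩ | rfl
      · refine .swapped (.out_arg _ _ _) (.out_arg _ _ _) ?_ ?_
        · have := guardedSize_le_sum Ts i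
          simp only [guardedSize]; omega
        · have := guardedSize_le_sum Us i
          simp only [guardedSize, Fin.cast_eq_self]; omega
      · refine .components (.out_cont _ _) (.out_cont _ _) ?_ ?_ <;>
          simp only [guardedSize] <;> omega
    · cases h
  · rename_i m l Ts n l' Us
    split at h
    · cases h
      refine ⟨(length_flatMap_filter_le (fun i j => decide (l' j = l i)) _).trans
        (by simp [arity]), fun J hJ => ?_⟩
      simp only [List.mem_flatMap, List.mem_map, List.mem_finRange, true_and] at hJ
      obtain ⟨i, j, -, rfl⟩ := hJ
      refine .components (.bra _ _ _) (.bra _ _ _) ?_ ?_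
      · have := guardedSize_le_sum Ts i
        simp only [guardedSize]; omega
      · have := guardedSize_le_sum Us j
        simp only [guardedSize]; omega
    · cases h
  · rename_i m l Ts n l' Us
    split at h
    · cases h
      refine ⟨(length_flatMap_filter_le (fun j i => decide (l i = l' j)) _).trans
        (by simp [arity, mul_comm]), fun J hJ => ?_⟩
      simp only [List.mem_flatMap, List.mem_map, List.mem_finRange, true_and] at hJ
      obtain ⟨j, i, -, rfl⟩ := hJ
      refine .components (.sel _ _ _) (.sel _ _ _) ?_ ?_
      · have := guardedSize_le_sum Ts i
        simp only [guardedSize]; omega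
      · have := guardedSize_le_sum Us j
        simp only [guardedSize]; omega
    · cases h
  · cases h

theorem ruleCost_le (T U : SType) {s : ℕ} (hT : ∀ X, Step T X → X.size ≤ s)
    (hU : ∀ X, Step U X → X.size ≤ s) :
    ruleCost T U ≤ (1 + T.arity) * (1 + U.arity) + s := by
  unfold ruleCost
  split
  · have := hT _ (Step.mu _)
    simp only [arity]; nlinarith
  · have := hU _ (Step.mu _)
    simp only [arity]; nlinarith
  · simp only [arity]; nlinarith
  · simp only [arity]; nlinarith
  · simp only [arity]; nlinarith
  · simp only [arity]; nlinarith
  · nlinarith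

theorem lookupCost_le {Γ : List (SType × SType)} {T U : SType} {s : ℕ}
    (hΓ : ∀ e ∈ Γ, e.1.size ≤ s ∧ e.2.size ≤ s) (hT : T.size ≤ s) (hU : U.size ≤ s) :
    lookupCost Γ T U ≤ 1 + Γ.length * (4 * s) := by
  refine Nat.add_le_add_left ((List.sum_le_card_nsmul _ (4 * s) fun x hx => ?_).trans
    (by simp)) 1
  obtain ⟨e, he, rfl⟩ := List.mem_map.1 hx
  have := hΓ e he
  omega

/-- The judgement is about a pair in `P` and assumes distinct pairs in `P`. -/
structure Judgement.Within (J : Judgement) (P : Finset (SType × SType)) : Prop where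
  mem : (J.lhs, J.rhs) ∈ P
  nodup : J.ctx.Nodup
  ctx_mem : ∀ e ∈ J.ctx, e ∈ P

theorem Judgement.Within.length_le {J : Judgement} {P : Finset (SType × SType)}
    (hJ : J.Within P) : J.ctx.length ≤ P.card := by
  rw [← List.toFinset_card_of_nodup hJ.nodup]
  exact Finset.card_le_card fun e he => hJ.ctx_mem e (List.mem_toFinset.1 he)

/-- A bound for the height of the derivation trees of a judgement. -/
def Judgement.rank (P : Finset (SType × SType)) (h : ℕ) (J : Judgement) : ℕ :=
  (P.card - J.ctx.length) * (h + 1) + min J.lhs.guardedSize J.rhs.guardedSize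

section Bounds

variable {P : Finset (SType × SType)} {h d s : ℕ}

theorem PairBound.cost_le (hP : PairBound P h d s) {J : Judgement} (hJ : J.Within P) :
    J.cost ≤ 1 + P.card * (4 * s) + ((1 + d) * (1 + d) + s) := by
  have h1 : lookupCost J.ctx J.lhs J.rhs ≤ 1 + P.card * (4 * s) := by
    refine (lookupCost_le (s := s) (fun e he => ?_) (hP.size_le hJ.mem)
      (hP.size_le (hP.symm hJ.mem))).trans ?_
    · have := hJ.ctx_mem e he
      exact ⟨hP.size_le this, hP.size_le (hP.symm this)⟩
    · exact Nat.add_le_add_left (Nat.mul_le_mul_right _ hJ.length_le) 1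
  have h2 : ruleCost J.lhs J.rhs ≤ (1 + d) * (1 + d) + s := by
    refine (ruleCost_le _ _ (s := s) (fun X hX => hP.size_le (hP.step hJ.mem hX))
      (fun X hX => hP.size_le (hP.step (hP.symm hJ.mem) hX))).trans ?_
    gcongr
    · exact hP.arity_le hJ.mem
    · exact hP.arity_le (hP.symm hJ.mem)
  unfold Judgement.cost
  split <;> omega

/-- Because (Assump) was tried before, an unfolding adds a new pair: the first summand of the rank
drops by `h + 1` while the second rises to at most `h`. The other rules keep the assumptions and
shrink both guarded sizes, hence their minimum. -/
theorem PairBound.premises_spec (hP : PairBound P h d s) {J : Judgement} (hJ : J.Within P)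
    {Ps : List Judgement} (hPs : J.premises = some Ps) :
    Ps.length ≤ d * d + 1 ∧ ∀ J' ∈ Ps, J'.Within P ∧ J'.rank P h < J.rank P h := by
  unfold Judgement.premises at hPs
  split at hPs
  · cases hPs
    simp
  · rename_i hmem
    obtain ⟨hlen, hprem⟩ := rulePremises_spec hPs
    refine ⟨hlen.trans ?_, fun J' hJ' => ?_⟩
    · gcongr
      · exact hP.arity_le hJ.mem
      · exact hP.arity_le (hP.symm hJ.mem)
    have grow : ∀ {X Y}, (X, Y) ∈ P →
        (Judgement.mk ((J.lhs, J.rhs) :: J.ctx) X Y).Within P ∧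
        (Judgement.mk ((J.lhs, J.rhs) :: J.ctx) X Y).rank P h < J.rank P h := by
      intro X Y hXY
      have hw : (Judgement.mk ((J.lhs, J.rhs) :: J.ctx) X Y).Within P :=
        ⟨hXY, List.nodup_cons.2 ⟨hmem, hJ.nodup⟩,
          List.forall_mem_cons.2 ⟨hJ.mem, hJ.ctx_mem⟩⟩
      refine ⟨hw, ?_⟩
      have h1 := hw.length_le
      have h2 := hP.guardedSize_le hXY
      simp only [List.length_cons] at h1
      obtain ⟨q, hq⟩ := Nat.exists_eq_add_of_le h1
      simp only [Judgement.rank, List.length_cons,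
        show P.card - (J.ctx.length + 1) = q by omega,
        show P.card - J.ctx.length = q + 1 by omega, add_mul, one_mul]
      omega
    have hmem' := hJ.mem
    rcases hprem J' hJ' with hX | hX | ⟨hX, hY, hX', hY'⟩ | ⟨hX, hY, hX', hY'⟩
    · exact grow (hP.step hmem' hX)
    · exact grow (hP.symm (hP.step (hP.symm hmem') hX))
    · refine ⟨⟨hP.symm (hP.step (hP.symm (hP.step hmem' hX)) hY), hJ.nodup, hJ.ctx_mem⟩, ?_⟩
      simp only [Judgement.rank]
      omega
    · refine ⟨⟨hP.step (hP.symm (hP.step hmem' hX)) hY, hJ.nodup, hJ.ctx_mem⟩, ?_⟩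
      simp only [Judgement.rank]
      omega

/-- The search halts, and a judgement of rank `q` adds at most `c * (d² + 2) ^ q` steps, where `c`
bounds the cost of a single judgement. -/
theorem PairBound.search_halts (hP : PairBound P h d s) (q : ℕ) :
    ∀ J : Judgement, J.Within P → J.rank P h ≤ q → ∀ (Js : List Judgement) (k : ℕ) (r : Outcome),
      search k Js = some r → ∃ k' r', search k' (J :: Js) = some r' ∧
        r'.steps ≤ r.steps +
          (1 + P.card * (4 * s) + ((1 + d) * (1 + d) + s)) * (d * d + 2) ^ q := by
  obtain ⟨c, hc⟩ : ∃ c, c = 1 + P.card * (4 * s) + ((1 + d) * (1 + d) + s) := ⟨_, rfl⟩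
  rw [← hc]
  induction q with
  | zero =>
    intro J hJ hrank Js k r hr
    have hcost : J.cost ≤ c := hc ▸ hP.cost_le hJ
    cases hPs : J.premises with
    | none => exact ⟨1, ⟨false, 1, J.cost⟩, by simp [search, hPs], by simp; omega⟩
    | some Ps =>
      have : Ps = [] := by
        refine List.eq_nil_iff_forall_not_mem.2 fun J' hJ' => ?_
        have := ((hP.premises_spec hJ hPs).2 J' hJ').2
        omega
      subst this
      exact ⟨k + 1, ⟨r.verdict, r.judgements + 1, r.steps + J.cost⟩, by simp [search, hPs, hr],
        by simpa using hcost⟩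
  | succ q ih =>
    intro J hJ hrank Js k r hr
    have hcost : J.cost ≤ c := hc ▸ hP.cost_le hJ
    have hpow : c ≤ c * (d * d + 2) ^ q := Nat.le_mul_of_pos_right c (by positivity)
    -- The base is one more than the maximal number of premises: the first summand pays for the
    -- judgement itself, the second for its premises.
    have hsucc : c * (d * d + 2) ^ (q + 1) =
        c * (d * d + 2) ^ q + (d * d + 1) * (c * (d * d + 2) ^ q) := by ring
    cases hPs : J.premises with
    | none =>
      exact ⟨1, ⟨false, 1, J.cost⟩, by simp [search, hPs], by
        rw [hsucc]; exact (hcost.trans hpow).trans (by omega)⟩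
    | some Ps =>
      obtain ⟨hlen, hprem⟩ := hP.premises_spec hJ hPs
      -- The premises are put on the stack from the last to the first, each on top of a stack
      -- already known to halt.
      have aux : ∀ Ls : List Judgement, (∀ J' ∈ Ls, J' ∈ Ps) → ∃ k' r',
          search k' (Ls ++ Js) = some r' ∧
            r'.steps ≤ r.steps + Ls.length * (c * (d * d + 2) ^ q) := by
        intro Ls
        induction Ls with
        | nil => exact fun _ => ⟨k, r, hr, by simp⟩
        | cons L Ls ihL =>
          intro hmem
          obtain ⟨k₁, r₁, h₁, hs₁⟩ := ihL fun J' hJ' => hmem J' (List.mem_cons_of_mem _ hJ')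
          obtain ⟨hw, hlt⟩ := hprem L (hmem L List.mem_cons_self)
          obtain ⟨k₂, r₂, h₂, hs₂⟩ := ih L hw (by omega) _ k₁ r₁ h₁
          refine ⟨k₂, r₂, h₂, hs₂.trans ?_⟩
          rw [List.length_cons, Nat.add_mul Ls.length, Nat.one_mul]
          omega
      obtain ⟨k', r', h', hs'⟩ := aux Ps fun _ h => h
      refine ⟨k' + 1, ⟨r'.verdict, r'.judgements + 1, r'.steps + J.cost⟩,
        by simp [search, hPs, h'], ?_⟩
      have := Nat.mul_le_mul_right (c * (d * d + 2) ^ q) hlen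
      simp only
      omega

end Bounds

/-- The pairs that occur in the search for `T ≤ U`. -/
theorem exists_pairBound {T U : SType} (hT : T.ClosedAt 0) (hU : U.ClosedAt 0) :
    ∃ P : Finset (SType × SType), (T, U) ∈ P ∧ P.card ≤ (T.size + U.size) ^ 2 / 2 ∧
      PairBound P ((T.size + U.size) / 2) (T.size + U.size)
        (2 * (T.size + U.size) ^ (T.size + U.size)) := by
  obtain ⟨A, hTA, hAcard, hAstep, hA⟩ := exists_finset_closed_under_step hT
  obtain ⟨B, hUB, hBcard, hBstep, hB⟩ := exists_finset_closed_under_step hU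
  have hT1 := T.one_le_size
  have hU1 := U.one_le_size
  have pow_le : ∀ {a b : ℕ}, 1 ≤ a → a ≤ b → 2 * a ^ a ≤ 2 * b ^ b := fun {a b} ha hab =>
    Nat.mul_le_mul_left _ ((Nat.pow_le_pow_left hab a).trans
      (Nat.pow_le_pow_right (ha.trans hab) hab))
  -- Both orders are needed because (Out) exchanges the sides of its payloads.
  refine ⟨A ×ˢ B ∪ B ×ˢ A, by simp [hTA, hUB], ?_, ?_⟩
  · refine (Finset.card_union_le _ _).trans ?_
    rw [Finset.card_product, Finset.card_product, Nat.le_div_iff_mul_le two_pos]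
    have := Nat.mul_le_mul hAcard hBcard
    zify at *
    nlinarith [sq_nonneg ((T.size : ℤ) - U.size)]
  · constructor
    · intro X Y hXY
      simp only [Finset.mem_union, Finset.mem_product] at hXY ⊢
      tauto
    · intro X X' Y hXY hX
      simp only [Finset.mem_union, Finset.mem_product] at hXY ⊢
      exact hXY.imp (fun h => ⟨hAstep _ h.1 _ hX, h.2⟩) (fun h => ⟨hBstep _ h.1 _ hX, h.2⟩)
    · intro X Y hXY
      simp only [Finset.mem_union, Finset.mem_product] at hXY
      rcases hXY with h | h
      · have h1 := (hA _ h.1).1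
        have h2 := (hB _ h.2).1
        omega
      · have h1 := (hB _ h.1).1
        have h2 := (hA _ h.2).1
        omega
    · intro X Y hXY
      simp only [Finset.mem_union, Finset.mem_product] at hXY
      rcases hXY with h | h
      · exact (hA _ h.1).2.1.trans (by omega)
      · exact (hB _ h.1).2.1.trans (by omega)
    · intro X Y hXY
      simp only [Finset.mem_union, Finset.mem_product] at hXY
      rcases hXY with h | h
      · exact (hA _ h.1).2.2.trans (pow_le hT1 (by omega))
      · exact (hB _ h.1).2.2.trans (pow_le hU1 (by omega))

/-! ### The bound `O(n^(n³))` -/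

/-- A bound for the number of steps on inputs of total size `n`. -/
def stepBound (n : ℕ) : ℕ :=
  (1 + n ^ 2 / 2 * (4 * (2 * n ^ n)) + ((1 + n) * (1 + n) + 2 * n ^ n)) *
    (n * n + 2) ^ (n ^ 2 / 2 * (n / 2 + 1) + n / 2)

theorem exists_runsTo_steps_le_stepBound {T U : SType} (hT : T.ClosedAt 0) (hU : U.ClosedAt 0) :
    ∃ r, RunsTo T U r ∧ r.steps ≤ stepBound (T.size + U.size) := by
  obtain ⟨P, hmem, hcard, hP⟩ := exists_pairBound hT hU
  have hw : (Judgement.mk [] T U).Within P := ⟨hmem, List.nodup_nil, by simp⟩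
  obtain ⟨k, r, hr, hs⟩ := hP.search_halts _ ⟨[], T, U⟩ hw le_rfl [] 0 ⟨true, 0, 0⟩ rfl
  refine ⟨r, ⟨k, hr⟩, hs.trans ?_⟩
  rw [zero_add, stepBound]
  have hrank : (Judgement.mk [] T U).rank P ((T.size + U.size) / 2) ≤
      (T.size + U.size) ^ 2 / 2 * ((T.size + U.size) / 2 + 1) + (T.size + U.size) / 2 :=
    Nat.add_le_add (Nat.mul_le_mul_right _ (by simpa using hcard)) (hP.guardedSize_le hmem)
  gcongr
  omega

/-- With `n² + 2 ≤ n³` the exponent is at most `3(n³/4 + n²/2 + n/2) + n + 4`, which is below `n³`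
from 10 on. -/
theorem stepBound_le {n : ℕ} (hn : 10 ≤ n) : stepBound n ≤ n ^ n ^ 3 := by
  have hcost : 1 + n ^ 2 / 2 * (4 * (2 * n ^ n)) + ((1 + n) * (1 + n) + 2 * n ^ n) ≤
      n ^ (n + 4) := by
    have h1 : n ^ 2 / 2 * 2 ≤ n ^ 2 := Nat.div_mul_le_self _ _
    have h2 : n ^ 2 ≤ n ^ n := Nat.pow_le_pow_right (by omega) (by omega)
    have h3 : n ^ 2 / 2 * (4 * (2 * n ^ n)) ≤ 4 * (n ^ 2 * n ^ n) := by
      nlinarith [Nat.mul_le_mul_right (n ^ n) h1]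
    have h4 : n ^ (n + 4) = n ^ 2 * (n ^ 2 * n ^ n) := by ring
    have h5 : 100 ≤ n ^ 2 := by nlinarith
    have h6 : n ^ n ≤ n ^ 2 * n ^ n := Nat.le_mul_of_pos_left _ (by positivity)
    have h7 : 100 * (n ^ 2 * n ^ n) ≤ n ^ 2 * (n ^ 2 * n ^ n) := Nat.mul_le_mul_right _ h5
    nlinarith
  have hbase : n * n + 2 ≤ n ^ 3 := by nlinarith [pow_succ n 2, sq n]
  refine (Nat.mul_le_mul hcost (Nat.pow_le_pow_left hbase _)).trans ?_
  rw [← pow_mul, ← pow_add]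
  refine Nat.pow_le_pow_right (by omega) ?_
  have h1 : n ^ 2 / 2 * 2 ≤ n ^ 2 := Nat.div_mul_le_self _ _
  have h2 : n / 2 * 2 ≤ n := Nat.div_mul_le_self _ _
  generalize n ^ 2 / 2 = p at *
  generalize n / 2 = h at *
  have h3 : (p * 2) * (h * 2 + 2) ≤ n ^ 2 * (n + 2) := Nat.mul_le_mul h1 (by omega)
  nlinarith

theorem exists_steps_le_mul_pow : ∃ C : ℕ, ∀ T U : SType, T.IsSessionType → U.IsSessionType →
    ∃ r : Outcome, RunsTo T U r ∧
      r.steps ≤ C * (T.size + U.size) ^ ((T.size + U.size) ^ 3) := by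
  -- The sum absorbs the inputs of total size below 10.
  refine ⟨1 + ∑ i ∈ Finset.range 10, stepBound i, fun T U hT hU => ?_⟩
  obtain ⟨r, hr, hs⟩ := exists_runsTo_steps_le_stepBound hT.closed hU.closed
  refine ⟨r, hr, hs.trans ?_⟩
  have hpos : 0 < T.size + U.size := Nat.add_pos_left T.one_le_size _
  generalize T.size + U.size = n at *
  rcases lt_or_ge n 10 with hn | hn
  · have h1 := Finset.single_le_sum (f := stepBound) (fun _ _ => Nat.zero_le _)
      (Finset.mem_range.2 hn)
    exact (h1.trans (Nat.le_add_left _ 1)).trans (Nat.le_mul_of_pos_right _ (by positivity))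
  · exact (stepBound_le hn).trans (Nat.le_mul_of_pos_left _ (by omega))

/-! ### Inputs on which the search never fails -/

namespace SType

/-- Every node is an input of one type, a recursion or a variable. -/
def UnaryInput : SType → Prop
  | @inp n Ts S => n = 1 ∧ (∀ i, (Ts i).UnaryInput) ∧ S.UnaryInput
  | mu T => T.UnaryInput
  | var _ => True
  | _ => False

theorem UnaryInput.subst {R T : SType} (hR : R.UnaryInput) (hT : T.UnaryInput) (k : ℕ) :
    (subst R k T).UnaryInput := by
  induction T generalizing k with
  | inp Ts S ih ihS => exact ⟨hT.1, fun i => ih i (hT.2.1 i) k, ihS hT.2.2 k⟩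
  | mu T ih => exact ih hT (k + 1)
  | var i =>
    simp only [SType.subst]
    split
    · exact hR
    · split <;> trivial
  | _ => exact hT.elim

theorem ClosedAt.subst {R T : SType} {k : ℕ} (hR : R.ClosedAt 0) (hT : T.ClosedAt (k + 1)) :
    (subst R k T).ClosedAt k := by
  induction T generalizing k with
  | tend => trivial
  | inp Ts S ih ihS => exact ⟨fun i => ih i (hT.1 i), ihS hT.2⟩
  | out Ts S ih ihS => exact ⟨fun i => ih i (hT.1 i), ihS hT.2⟩
  | sel l Ts ih => exact fun i => ih i (hT i)
  | bra l Ts ih => exact fun i => ih i (hT i)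
  | mu T ih => exact ih (k := k + 1) hT
  | var i =>
    have : i < k + 1 := hT
    simp only [SType.subst]
    split
    · exact hR.mono (Nat.zero_le k)
    · rw [if_neg (by omega)]
      show i < k
      omega

/-- A closed unary-input type: its infinite unfolding is the full binary tree of inputs. -/
structure Binary (T : SType) : Prop where
  closed : T.ClosedAt 0
  unaryInput : T.UnaryInput

theorem Binary.unroll {T : SType} (h : (mu T).Binary) : T.unroll.Binary :=
  ⟨ClosedAt.subst h.closed (k := 0) h.closed, UnaryInput.subst (T := T) h.unaryInput h.unaryInput 0⟩

theorem Binary.cases {T : SType} (h : T.Binary) :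
    (∃ R, T = mu R) ∨ ∃ V S : SType, V.Binary ∧ S.Binary ∧ T = inp (fun _ : Fin 1 => V) S := by
  cases T with
  | mu R => exact .inl ⟨R, rfl⟩
  | inp Ts S =>
    obtain ⟨rfl, h1, h2⟩ := h.unaryInput
    refine .inr ⟨Ts 0, S, ⟨h.closed.1 0, h1 0⟩, ⟨h.closed.2, h2⟩, ?_⟩
    congr
    funext i
    rw [Subsingleton.elim i 0]
  | var i => exact absurd h.closed (Nat.not_lt_zero i)
  | _ => exact h.unaryInput.elim

end SType

/-- Both sides of the judgement are binary. -/
def Judgement.Binary (J : Judgement) : Prop := J.lhs.Binary ∧ J.rhs.Binary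

/-- Once recursion is unfolded, both sides are inputs of one type, so (In) always applies. The
search therefore cannot stop early with "false", and every pending judgement is visited. -/
theorem Judgement.Binary.premises {J : Judgement} (hJ : J.Binary) :
    ∃ Ps, J.premises = some Ps ∧ ∀ J' ∈ Ps, J'.Binary := by
  obtain ⟨Γ, T, U⟩ := J
  obtain ⟨hT, hU⟩ : T.Binary ∧ U.Binary := hJ
  by_cases hmem : (T, U) ∈ Γ
  · exact ⟨[], by simp [Judgement.premises, hmem], by simp⟩
  simp only [Judgement.premises, hmem, if_false]
  rcases hT.cases with ⟨R, rfl⟩ | ⟨V, S, hV, hS, rfl⟩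
  · exact ⟨_, by rw [rulePremises], by simpa using ⟨hT.unroll, hU⟩⟩
  rcases hU.cases with ⟨R, rfl⟩ | ⟨V', S', hV', hS', rfl⟩
  · exact ⟨_, rfl, by simpa using ⟨hT, hU.unroll⟩⟩
  · exact ⟨[⟨Γ, V, V'⟩, ⟨Γ, S, S'⟩], by simp [rulePremises], by
      simpa using ⟨⟨hV, hV'⟩, ⟨hS, hS'⟩⟩⟩

/-- Replacing a binary judgement by its premises keeps the upper part of the stack binary, so a
halting run must exhaust that part and reach `Js`. -/
theorem search_append_binary {k : ℕ} : ∀ {Ls Js : List Judgement} {r : Outcome},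
    (∀ J ∈ Ls, J.Binary) → search k (Ls ++ Js) = some r →
      ∃ k' r', search k' Js = some r' ∧ r'.judgements ≤ r.judgements := by
  induction k with
  | zero =>
    rintro (_ | ⟨L, Ls⟩) Js r hL hr
    · exact ⟨0, r, hr, le_rfl⟩
    · simp [search] at hr
  | succ k ih =>
    rintro (_ | ⟨L, Ls⟩) Js r hL hr
    · exact ⟨k + 1, r, hr, le_rfl⟩
    obtain ⟨hL1, hLs⟩ := List.forall_mem_cons.1 hL
    obtain ⟨Ps, hPs, hbin⟩ := hL1.premises
    simp only [List.cons_append, search, hPs, Option.map_eq_some_iff, ← List.append_assoc] at hr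
    obtain ⟨a, ha, rfl⟩ := hr
    obtain ⟨k', r', h', hle⟩ := ih (Ls := Ps ++ Ls) (fun J hJ =>
      (List.mem_append.1 hJ).elim (hbin J) (hLs J)) ha
    exact ⟨k', r', h', hle.trans (Nat.le_succ _)⟩

/-- The search passes the judgement, and visits at least `N` judgements before it does so. -/
def Judgement.VisitsAtLeast (J : Judgement) (N : ℕ) : Prop :=
  ∀ k Js r, search k (J :: Js) = some r →
    ∃ k' r', search k' Js = some r' ∧ r'.judgements + N ≤ r.judgements

theorem Judgement.VisitsAtLeast.mono {J : Judgement} {M N : ℕ} (h : J.VisitsAtLeast N)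
    (hMN : M ≤ N) : J.VisitsAtLeast M := by
  intro k Js r hr
  obtain ⟨k', r', h', hle⟩ := h _ _ _ hr
  exact ⟨k', r', h', by omega⟩

theorem Judgement.Binary.visitsAtLeast_one {J : Judgement} (hJ : J.Binary) :
    J.VisitsAtLeast 1 := by
  intro k Js r hr
  cases k with
  | zero => simp [search] at hr
  | succ k =>
    obtain ⟨Ps, hPs, hbin⟩ := hJ.premises
    simp only [search, hPs, Option.map_eq_some_iff] at hr
    obtain ⟨a, ha, rfl⟩ := hr
    obtain ⟨k', r', h', hle⟩ := search_append_binary hbin ha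
    exact ⟨k', r', h', Nat.succ_le_succ hle⟩

theorem Judgement.VisitsAtLeast.of_single {J J' : Judgement} {N : ℕ}
    (hJ : J.premises = some [J']) (h : J'.VisitsAtLeast N) : J.VisitsAtLeast N := by
  intro k Js r hr
  cases k with
  | zero => simp [search] at hr
  | succ k =>
    simp only [search, hJ, Option.map_eq_some_iff] at hr
    obtain ⟨a, ha, rfl⟩ := hr
    obtain ⟨k', r', h', hle⟩ := h _ _ _ ha
    exact ⟨k', r', h', hle.trans (Nat.le_succ _)⟩

theorem Judgement.VisitsAtLeast.of_pair {J J₁ J₂ : Judgement} {M N : ℕ}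
    (hJ : J.premises = some [J₁, J₂]) (h₁ : J₁.VisitsAtLeast M) (h₂ : J₂.VisitsAtLeast N) :
    J.VisitsAtLeast (M + N) := by
  intro k Js r hr
  cases k with
  | zero => simp [search] at hr
  | succ k =>
    simp only [search, hJ, Option.map_eq_some_iff] at hr
    obtain ⟨a, ha, rfl⟩ := hr
    obtain ⟨k₁, r₁, hr₁, hle₁⟩ := h₁ _ _ _ ha
    obtain ⟨k₂, r₂, hr₂, hle₂⟩ := h₂ _ _ _ hr₁
    refine ⟨k₂, r₂, hr₂, ?_⟩
    simp only
    omega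

/-! ### The ladder and its exponential derivations -/

section Family

/-- `?[V].S`. -/
abbrev inp₁ (V S : SType) : SType := inp (fun _ : Fin 1 => V) S

/-- `μX.?[X].?[X].X`. -/
def loop : SType := mu (inp₁ (var 0) (inp₁ (var 0) (var 0)))

/-- `μX₀.…μX_d.?[X_d].X_d`. -/
def base : ℕ → SType
  | 0 => mu (inp₁ (var 0) (var 0))
  | d + 1 => mu (base d)

/-- `μZ_j.?[Z_j].μZ_{j-1}.?[Z_{j-1}].….base d`. -/
def ladder (d : ℕ) : ℕ → SType
  | 0 => base d
  | j + 1 => mu (inp₁ (var 0) (ladder d j))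

theorem closedAt_base (d k : ℕ) : (base d).ClosedAt k := by
  induction d generalizing k with
  | zero => simp [base, ClosedAt]
  | succ d ih => exact ih (k + 1)

theorem size_base (d : ℕ) : (base d).size = d + 4 := by
  induction d with
  | zero => simp [base, size]
  | succ d ih => simp [base, size, ih]

theorem closedAt_ladder (d j k : ℕ) : (ladder d j).ClosedAt k := by
  induction j generalizing k with
  | zero => exact closedAt_base d k
  | succ j ih => exact ⟨fun _ => Nat.succ_pos k, ih (k + 1)⟩

/-- A rung costs three symbols; the `d` vacuous binders at the bottom are padding that lets every
residue modulo 3 occur. -/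
theorem size_ladder (d j : ℕ) : (ladder d j).size = 3 * j + d + 4 := by
  induction j with
  | zero => simp [ladder, size_base]
  | succ j ih => simp [ladder, size, ih]; omega

theorem unaryInput_base (d : ℕ) : (base d).UnaryInput := by
  induction d with
  | zero => simp [base, UnaryInput]
  | succ d ih => exact ih

theorem unaryInput_ladder (d j : ℕ) : (ladder d j).UnaryInput := by
  induction j with
  | zero => exact unaryInput_base d
  | succ j ih => exact ⟨rfl, fun _ => trivial, ih⟩

theorem binary_ladder (d j : ℕ) : (ladder d j).Binary :=
  ⟨closedAt_ladder d j 0, unaryInput_ladder d j⟩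

theorem binary_loop : loop.Binary := by
  constructor <;> simp [loop, ClosedAt, UnaryInput]

theorem binary_inp₁ {V S : SType} (hV : V.Binary) (hS : S.Binary) : (inp₁ V S).Binary :=
  ⟨⟨fun _ => hV.closed, hS.closed⟩, rfl, fun _ => hV.unaryInput, hS.unaryInput⟩

theorem base_ne_mus_var (d k i : ℕ) : base d ≠ mus k (var i) := by
  induction d generalizing k with
  | zero => rcases k with _ | _ | k <;> simp [base, mus]
  | succ d ih =>
    rcases k with _ | k
    · simp [base, mus]
    · simpa [base, mus] using ih k

theorem inp₁_ne_mus_var (V S : SType) (k i : ℕ) : inp₁ V S ≠ mus k (var i) := by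
  cases k <;> simp [mus]

theorem isSessionType_loop : loop.IsSessionType :=
  ⟨binary_loop.closed, ⟨fun k => inp₁_ne_mus_var _ _ k k, by simp [Contractive]⟩,
    by simp [loop, LabelsDistinct]⟩

theorem isSessionType_ladder (d j : ℕ) : (ladder d j).IsSessionType := by
  refine ⟨closedAt_ladder d j 0, ?_, ?_⟩
  · induction j with
    | zero =>
      induction d with
      | zero => exact ⟨fun k => inp₁_ne_mus_var _ _ k k, by simp [Contractive]⟩
      | succ d ih => exact ⟨fun k => base_ne_mus_var d k k, ih⟩
    | succ j ih => exact ⟨fun k => inp₁_ne_mus_var _ _ k k, fun _ => trivial, ih⟩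
  · induction j with
    | zero =>
      induction d with
      | zero => simp [ladder, base, LabelsDistinct]
      | succ d ih => exact ih
    | succ j ih => exact ⟨fun _ => trivial, ih⟩

theorem unroll_loop :
    unroll (inp₁ (var 0) (inp₁ (var 0) (var 0))) = inp₁ loop (inp₁ loop loop) := by
  simp [unroll, subst, loop]

theorem unroll_ladder (d j : ℕ) :
    unroll (inp₁ (var 0) (ladder d j)) = inp₁ (ladder d (j + 1)) (ladder d j) := by
  simp [unroll, subst, (closedAt_ladder d j 0).subst_eq, ladder]

/-- The right sides of all assumptions are larger than `s`. -/
def RhsAbove (s : ℕ) (Γ : List (SType × SType)) : Prop := ∀ e ∈ Γ, s < e.2.size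

theorem RhsAbove.not_mem {s : ℕ} {Γ : List (SType × SType)} (h : RhsAbove s Γ) {T U : SType}
    (hU : U.size ≤ s) : (T, U) ∉ Γ := fun hm => (h _ hm).not_ge hU

theorem RhsAbove.mono {s t : ℕ} {Γ : List (SType × SType)} (h : RhsAbove s Γ) (hts : t ≤ s) :
    RhsAbove t Γ := fun e he => hts.trans_lt (h e he)

theorem RhsAbove.cons {s : ℕ} {Γ : List (SType × SType)} (h : RhsAbove s Γ) (T : SType)
    {U : SType} (hU : s < U.size) : RhsAbove s ((T, U) :: Γ) :=
  List.forall_mem_cons.2 ⟨hU, h⟩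

theorem premises_inp₁_ladder {Γ : List (SType × SType)} {V S : SType} {d j : ℕ}
    (h : (inp₁ V S, ladder d (j + 1)) ∉ Γ) :
    (Judgement.mk Γ (inp₁ V S) (ladder d (j + 1))).premises =
      some [⟨(inp₁ V S, ladder d (j + 1)) :: Γ, inp₁ V S,
        inp₁ (ladder d (j + 1)) (ladder d j)⟩] := by
  rw [Judgement.premises, if_neg h, ← unroll_ladder]
  rfl

theorem premises_inp₁_inp₁ {Γ : List (SType × SType)} {V S V' S' : SType}
    (h : (inp₁ V S, inp₁ V' S') ∉ Γ) :
    (Judgement.mk Γ (inp₁ V S) (inp₁ V' S')).premises = some [⟨Γ, V, V'⟩, ⟨Γ, S, S'⟩] := by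
  rw [Judgement.premises, if_neg h]
  simp [rulePremises]

theorem premises_loop {Γ : List (SType × SType)} {U : SType} (h : (loop, U) ∉ Γ) :
    (Judgement.mk Γ loop U).premises =
      some [⟨(loop, U) :: Γ, inp₁ loop (inp₁ loop loop), U⟩] := by
  rw [Judgement.premises, if_neg h, ← unroll_loop]
  simp only [loop, rulePremises]

/-- The right sides of all assumptions are rungs of the ladder. -/
def NoUnfolding (d : ℕ) (Γ : List (SType × SType)) : Prop :=
  ∀ e ∈ Γ, ∃ j, e.2 = ladder d j

theorem NoUnfolding.not_mem {d : ℕ} {Γ : List (SType × SType)} (h : NoUnfolding d Γ)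
    (T V S : SType) : (T, inp₁ V S) ∉ Γ := by
  intro hm
  obtain ⟨j, hj⟩ := h _ hm
  cases j with
  | zero => cases d <;> simp [ladder, base] at hj
  | succ j => simp [ladder] at hj

theorem NoUnfolding.cons {d : ℕ} {Γ : List (SType × SType)} (h : NoUnfolding d Γ) (T : SType)
    (j : ℕ) : NoUnfolding d ((T, ladder d j) :: Γ) :=
  List.forall_mem_cons.2 ⟨⟨j, rfl⟩, h⟩

theorem loop_ne_inp₁ (V S : SType) : loop ≠ inp₁ V S := by simp [loop]

/-- After unfolding left and then right, (In) yields the payload `loop ≤ ladder d (j + 1)`, which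
has just been assumed, and the continuation `?[loop].loop ≤ ladder d j`, which carries the work one
rung lower. -/
theorem visitsAtLeast_loop {d j N : ℕ} {Γ : List (SType × SType)} (hΓ : NoUnfolding d Γ)
    (h1 : (loop, ladder d (j + 1)) ∉ Γ)
    (h2 : (inp₁ loop (inp₁ loop loop), ladder d (j + 1)) ∉ Γ)
    (h : RhsAbove (ladder d j).size Γ)
    (hN : ∀ Γ', NoUnfolding d Γ' → RhsAbove (ladder d j).size Γ' →
      (Judgement.mk Γ' (inp₁ loop loop) (ladder d j)).VisitsAtLeast N) :
    (Judgement.mk Γ loop (ladder d (j + 1))).VisitsAtLeast N := by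
  have hlt : (ladder d j).size < (ladder d (j + 1)).size := by simp only [size_ladder]; omega
  refine .of_single (premises_loop h1) ?_
  refine .of_single (premises_inp₁_ladder ?_) ?_
  · simpa [(loop_ne_inp₁ _ _).symm] using h2
  have hΓ' := (hΓ.cons loop (j + 1)).cons (inp₁ loop (inp₁ loop loop)) (j + 1)
  refine (Judgement.VisitsAtLeast.of_pair (premises_inp₁_inp₁ (hΓ'.not_mem _ _ _))
    (Judgement.Binary.visitsAtLeast_one ⟨binary_loop, binary_ladder _ _⟩)
    (hN _ hΓ' ((h.cons _ hlt).cons _ hlt))).mono (by omega)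

/-- Unfolding rung `j + 2` leaves `loop` against rung `j + 2` (payload) and against rung `j + 1`
(continuation), hence `?[loop].loop` against rungs `j + 1` and `j`. Right sides of earlier
assumptions are larger, so (Assump) cannot cut these branches short. -/
theorem visitsAtLeast_pow (d : ℕ) (j : ℕ) : ∀ Γ, NoUnfolding d Γ →
    RhsAbove (ladder d j).size Γ →
      (Judgement.mk Γ (inp₁ loop loop) (ladder d j)).VisitsAtLeast (2 ^ (j / 2)) := by
  have one : ∀ (j : ℕ) Γ, (Judgement.mk Γ (inp₁ loop loop) (ladder d j)).VisitsAtLeast 1 :=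
    fun j Γ => Judgement.Binary.visitsAtLeast_one
      ⟨binary_inp₁ binary_loop binary_loop, binary_ladder _ _⟩
  induction j using Nat.strong_induction_on with
  | _ j ih =>
  match j, ih with
  | 0, _ => exact fun Γ _ _ => one 0 Γ
  | 1, _ => exact fun Γ _ _ => one 1 Γ
  | j + 2, ih =>
    intro Γ hΓ h
    have hlt : ∀ i, (ladder d i).size < (ladder d (i + 1)).size := fun i => by
      simp only [size_ladder]; omega
    have hne : (inp₁ loop loop : SType) ≠ inp₁ loop (inp₁ loop loop) := by
      intro he
      injection he with _ _ he
      exact loop_ne_inp₁ _ _ he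
    refine .of_single (premises_inp₁_ladder (h.not_mem le_rfl)) ?_
    have hΓ' := hΓ.cons (inp₁ loop loop) (j + 2)
    have h' : RhsAbove (ladder d (j + 1)).size ((inp₁ loop loop, ladder d (j + 2)) :: Γ) :=
      (h.mono (hlt (j + 1)).le).cons _ (hlt (j + 1))
    have left : (Judgement.mk ((inp₁ loop loop, ladder d (j + 2)) :: Γ) loop
        (ladder d (j + 2))).VisitsAtLeast (2 ^ ((j + 1) / 2)) := by
      -- Here the newest assumption has the same right side; only its left side keeps (Assump) from
      -- applying.
      refine visitsAtLeast_loop hΓ' ?_ ?_ h' (ih (j + 1) (by omega))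
      · simpa [loop_ne_inp₁] using h.not_mem le_rfl
      · simpa [hne.symm] using h.not_mem le_rfl
    have right : (Judgement.mk ((inp₁ loop loop, ladder d (j + 2)) :: Γ) loop
        (ladder d (j + 1))).VisitsAtLeast (2 ^ (j / 2)) :=
      visitsAtLeast_loop hΓ' (h'.not_mem le_rfl) (h'.not_mem le_rfl)
        (h'.mono (hlt j).le) (ih j (by omega))
    refine (Judgement.VisitsAtLeast.of_pair (premises_inp₁_inp₁ (hΓ'.not_mem _ _ _))
      left right).mono ?_
    rw [show (j + 2) / 2 = j / 2 + 1 by omega, pow_succ, mul_two]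
    gcongr <;> omega

end Family

theorem one_le_cost (J : Judgement) : 1 ≤ J.cost := by
  unfold Judgement.cost lookupCost
  split <;> omega

theorem search_judgements_le_steps {k : ℕ} : ∀ {Js : List Judgement} {r : Outcome},
    search k Js = some r → r.judgements ≤ r.steps := by
  induction k with
  | zero =>
    rintro (_ | ⟨J, Js⟩) r h
    · obtain rfl : _ = r := by simpa [search] using h
      exact le_rfl
    · simp [search] at h
  | succ k ih =>
    rintro (_ | ⟨J, Js⟩) r h
    · obtain rfl : _ = r := by simpa [search] using h
      exact le_rfl
    · have hc := one_le_cost J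
      rw [search] at h
      cases hp : J.premises with
      | none =>
        obtain rfl : _ = r := by simpa [hp] using h
        exact hc
      | some Ps =>
        simp only [hp, Option.map_eq_some_iff] at h
        obtain ⟨a, ha, rfl⟩ := h
        exact Nat.add_le_add (ih ha) hc

theorem exists_runsTo_pow_le_judgements (d m : ℕ) :
    ∃ r, RunsTo loop (ladder d (m + 1)) r ∧ 2 ^ (m / 2) ≤ r.judgements ∧
      r.judgements ≤ r.steps := by
  -- `VisitsAtLeast` speaks only of halting runs; halting comes from the upper bound.
  obtain ⟨r, ⟨k, hk⟩, -⟩ := exists_runsTo_steps_le_stepBound isSessionType_loop.closed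
    (closedAt_ladder d (m + 1) 0)
  have hv : (Judgement.mk [] loop (ladder d (m + 1))).VisitsAtLeast (2 ^ (m / 2)) :=
    visitsAtLeast_loop (fun e he => by simp at he) (by simp) (by simp)
      (fun e he => by simp at he) (visitsAtLeast_pow d m)
  obtain ⟨_, _, _, hle⟩ := hv _ _ _ hk
  exact ⟨r, ⟨k, hk⟩, by omega, search_judgements_le_steps hk⟩

theorem size_loop : loop.size = 6 := by simp [loop, size]

/-- Inputs of each total size `n ≥ 13` on which exponentially many judgements are visited. -/
theorem exists_pow_le_judgements {n : ℕ} (hn : 13 ≤ n) :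
    ∃ T U : SType, T.IsSessionType ∧ U.IsSessionType ∧ T.size + U.size = n ∧
      ∃ r, RunsTo T U r ∧ 2 ^ ((n - 13) / 6) ≤ r.judgements ∧ r.judgements ≤ r.steps := by
  obtain ⟨r, hr, h1, h2⟩ := exists_runsTo_pow_le_judgements ((n - 13) % 3) ((n - 13) / 3)
  refine ⟨loop, ladder _ _, isSessionType_loop, isSessionType_ladder _ _, ?_, r, hr, ?_, h2⟩
  · rw [size_loop, size_ladder]
    omega
  · rwa [Nat.div_div_eq_div_mul] at h1

/-! ### Comparison of growth rates -/

theorem eventually_factorial_sqrt_le_two_pow :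
    ∀ᶠ n : ℕ in Filter.atTop, (n.sqrt + 1).factorial ≤ 2 ^ ((n - 13) / 6) := by
  have h : ∀ᶠ k : ℕ in Filter.atTop, k ^ 24 ≤ 2 ^ k := by
    have h1 := (tendsto_pow_const_div_const_pow_of_one_lt 24 (r := (2 : ℝ)) one_lt_two).eventually
      (gt_mem_nhds one_pos)
    filter_upwards [h1] with k hk
    rw [div_lt_one (by positivity)] at hk
    exact_mod_cast hk.le
  have hsqrt : Filter.Tendsto (fun n : ℕ => n.sqrt + 1) Filter.atTop Filter.atTop := by
    refine Filter.tendsto_atTop.2 fun b => ?_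
    filter_upwards [Filter.eventually_ge_atTop (b * b)] with n hn
    exact (Nat.le_sqrt.2 hn).trans (Nat.le_succ _)
  filter_upwards [hsqrt.eventually h, hsqrt.eventually_ge_atTop 30] with n hn hk
  have hsq : n.sqrt * n.sqrt ≤ n := Nat.sqrt_le n
  set k := n.sqrt + 1 with hkdef
  have hn' : (k - 1) * (k - 1) ≤ n := by simpa [hkdef] using hsq
  -- The power 24 turns the exponent `(n - 13) / 6` into about `4n`, which leaves room over `k² ≈ n`
  -- despite the rounding.
  refine (Nat.pow_le_pow_iff_left (n := 24) (by norm_num)).1 ?_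
  calc k.factorial ^ 24 ≤ (k ^ k) ^ 24 := Nat.pow_le_pow_left (Nat.factorial_le_pow k) 24
    _ = (k ^ 24) ^ k := by rw [← pow_mul, ← pow_mul, mul_comm]
    _ ≤ (2 ^ k) ^ k := Nat.pow_le_pow_left hn k
    _ = 2 ^ (k * k) := (pow_mul _ _ _).symm
    _ ≤ 2 ^ ((n - 13) / 6 * 24) := by
        refine Nat.pow_le_pow_right two_pos ?_
        obtain ⟨j, hj⟩ : ∃ j, k = j + 1 := ⟨_, hkdef⟩
        rw [hj] at hn' hk ⊢
        rw [Nat.add_sub_cancel] at hn'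
        have : (n - 13) / 6 * 24 + 75 ≥ 4 * n := by omega
        nlinarith
    _ = (2 ^ ((n - 13) / 6)) ^ 24 := pow_mul _ _ _

/-- Monotonicity of Γ is used on `[2, ∞)`, which contains `√n + 1` once `n ≥ 1`. -/
theorem gamma_sqrt_add_one_le_factorial {n : ℕ} (hn : 1 ≤ n) :
    Real.Gamma (√(n : ℝ) + 1) ≤ ((n.sqrt + 1).factorial : ℝ) := by
  rw [← Real.Gamma_nat_eq_factorial]
  have h1 : (1 : ℝ) ≤ √(n : ℝ) := Real.one_le_sqrt.2 (by exact_mod_cast hn)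
  have h2 : √(n : ℝ) ≤ ((n.sqrt + 1 : ℕ) : ℝ) := by
    rw [Real.sqrt_le_left (by positivity)]
    exact_mod_cast (Nat.lt_succ_sqrt' n).le
  refine Real.Gamma_strictMonoOn_Ici.monotoneOn ?_ ?_ (by linarith)
  · simp only [Set.mem_Ici]; linarith
  · simp only [Set.mem_Ici]; linarith

/-- Eventually `n³ + 1 ≤ 2ⁿ`, and the spare factor `n` exceeds any `1 / c`. -/
theorem pow_pow_three_isLittleO :
    (fun n : ℕ => (n : ℝ) ^ (n ^ 3)) =o[Filter.atTop] (fun n : ℕ => (n : ℝ) ^ (2 ^ n)) := by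
  have h : ∀ᶠ n : ℕ in Filter.atTop, n ^ 3 + 1 ≤ 2 ^ n := by
    have h1 := (tendsto_pow_const_div_const_pow_of_one_lt 3 (r := (2 : ℝ)) one_lt_two).eventually
      (gt_mem_nhds one_pos)
    filter_upwards [h1] with k hk
    rw [div_lt_one (by positivity)] at hk
    exact_mod_cast hk
  refine Asymptotics.isLittleO_iff.2 fun c hc => ?_
  filter_upwards [h, Filter.eventually_ge_atTop 1,
    tendsto_natCast_atTop_atTop.eventually_ge_atTop (1 / c)] with n hn h1 hcn
  have hn1 : (1 : ℝ) ≤ n := by exact_mod_cast h1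
  rw [Real.norm_of_nonneg (by positivity), Real.norm_of_nonneg (by positivity)]
  have h2 : 1 ≤ c * n := by rwa [div_le_iff₀' hc] at hcn
  calc (n : ℝ) ^ (n ^ 3) ≤ c * n * (n : ℝ) ^ (n ^ 3) := le_mul_of_one_le_left (by positivity) h2
    _ = c * (n : ℝ) ^ (n ^ 3 + 1) := by ring
    _ ≤ c * (n : ℝ) ^ (2 ^ n) := by gcongr

end SessionSubtyping

theorem mainTheorem4 :
    (∃ C : ℕ, ∀ T U : SessionSubtyping.SType, T.IsSessionType → U.IsSessionType →
      ∃ r : SessionSubtyping.Outcome, SessionSubtyping.RunsTo T U r ∧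
        r.steps ≤ C * (T.size + U.size) ^ ((T.size + U.size) ^ 3)) ∧
    (∃ c : ℝ, 0 < c ∧ ∀ᶠ n : ℕ in Filter.atTop,
      ∃ T U : SessionSubtyping.SType, T.IsSessionType ∧ U.IsSessionType ∧
        T.size + U.size = n ∧
        ∃ r : SessionSubtyping.Outcome, SessionSubtyping.RunsTo T U r ∧
          c * Real.Gamma (√(n : ℝ) + 1) ≤ (r.judgements : ℝ) ∧ r.judgements ≤ r.steps) ∧
    (fun n : ℕ => (n : ℝ) ^ (n ^ 3)) =o[Filter.atTop] (fun n : ℕ => (n : ℝ) ^ (2 ^ n)) := by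
  refine ⟨SessionSubtyping.exists_steps_le_mul_pow, ⟨1, one_pos, ?_⟩,
    SessionSubtyping.pow_pow_three_isLittleO⟩
  filter_upwards [SessionSubtyping.eventually_factorial_sqrt_le_two_pow,
    Filter.eventually_ge_atTop 13] with n hfac hn
  obtain ⟨T, U, hT, hU, hsize, r, hr, h1, h2⟩ := SessionSubtyping.exists_pow_le_judgements hn
  refine ⟨T, U, hT, hU, hsize, r, hr, ?_, h2⟩
  rw [one_mul]
  refine (SessionSubtyping.gamma_sqrt_add_one_le_factorial (by omega)).trans ?_
  exact_mod_cast hfac.trans h1
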